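/- A discrete filtered set is a family $\Omega=(\Omega_L)_{L\in\mathbb R_{\ge 0}}$ of finite subsets of $\mathbb C$ such that $\Omega_{L_1}\subseteq\Omega_{L_2}$ for $L_1\le L_2$ and $\Omega_\delta=\emptyset$ for some $\delta>0$. Let $\mathcal S_\Omega=\{(\lambda,\omega)\in\mathbb R\times\mathbb C : \lambda\ge 0,\ \omega\in\Omega_\lambda\}$ and $\mathcal M_\Omega=(\mathbb R\times\mathbb C)\setminus\overline{\mathcal S_\Omega}$. An $\Omega$-allowed path is a Lipschitz path $\gamma:[0,t_*]\to\mathbb C$ $(t_*\ge 0)$ with $\gamma(0)=0$ such that $(L(\gamma|_{[0,t]}),\gamma(t))\in\mathcal M_\Omega$ for all $t\in[0,t_*]$, where $L$ denotes the length. A holomorphic germ $\hat\varphi\in\mathcal O_{\mathbb C,0}$ is $\Omega$-continuable if it can be analytically continued along every $\Omega$-allowed path; $\hat{\mathscr R}_\Omega$ denotes the set of all such germs. An $\Omega$-endless Riemann surface is a triple $(X,\mathfrak p,\underline 0)$ in which $X$ is a connected Riemann surface, $\mathfrak p:X\to\mathbb C$ is a local biholomorphism, $\underline 0\in\mathfrak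 p^{-1}(0)$, and every $\Omega$-allowed path $\gamma:[0,1]\to\mathbb C$ has a lift $\underline\gamma:[0,1]\to X$ with $\underline\gamma(0)=\underline 0$. A morphism $(X,\mathfrak p,\underline 0)\to(X',\mathfrak p',\underline 0')$ is a local biholomorphism $\mathfrak q:X\to X'$ with $\mathfrak p'\circ\mathfrak q=\mathfrak p$ and $\mathfrak q(\underline 0)=\underline 0'$. Proposition. Let $\Omega$ be a discrete filtered set. The category of $\Omega$-endless Riemann surfaces has an initial object, and every initial object $(X_\Omega,\mathfrak p_\Omega,\underline 0_\Omega)$ has the following properties. (a) For every $\hat\varphi\in\mathcal O_{\mathbb C,0}$ the following are equivalent: (i) $\hat\varphi$ is $\Omega$-continuable; (ii) $\mathfrak p_\Omega^*\hat\varphi\in\mathcal O_{X_\Omega,\underline 0_\Omega}$ can be analytically continued along every path of $X_\Omega$ starting at $\underline 0_\Omega$; (iii) $\mathfrak p_\Omega^*\hat\varphi$ is the germ at $\underline 0_\Omega$ of a global holomorphic function on $X_\Omega$, that is, of an element of $\Gamma(X_\Omega,\mathcal O_{X_\Omega})$. (b) There is exactly one bijection $\Phi:\hat{\mathscr R}_\Omega\to\Gamma(X_\Omega,\mathcal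 O_{X_\Omega})$ such that, for every $\hat\varphi\in\hat{\mathscr R}_\Omega$, the germ of $\Phi(\hat\varphi)$ at $\underline 0_\Omega$ is $\mathfrak p_\Omega^*\hat\varphi$. In other words, $\mathfrak p_\Omega^*$ induces a bijection $\hat{\mathscr R}_\Omega\to\Gamma(X_\Omega,\mathcal O_{X_\Omega})$. -/

import Mathlib

open Set Filter Topology
open scoped Manifold ContDiff NNReal

/-! ### Discrete filtered sets and allowed paths -/

/-- A discrete filtered set: a nondecreasing family of finite subsets of `ℂ` indexed by `ℝ≥0`,
one of whose members with positive index is empty. -/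
structure DiscreteFilteredSet where
  /-- the member of index `L` of the family -/
  part : ℝ≥0 → Set ℂ
  finite_part : ∀ L, (part L).Finite
  mono : ∀ L₁ L₂, L₁ ≤ L₂ → part L₁ ⊆ part L₂
  exists_part_eq_empty : ∃ δ : ℝ≥0, 0 < δ ∧ part δ = ∅

namespace DiscreteFilteredSet

/-- The subset `{(λ, ω) | λ ≥ 0, ω ∈ Ω_λ}` of `ℝ × ℂ`. -/
def singularSet (Ω : DiscreteFilteredSet) : Set (ℝ × ℂ) :=
  {q | ∃ L : ℝ≥0, q.1 = (L : ℝ) ∧ q.2 ∈ Ω.part L}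

/-- The allowed open set: the complement of the closure of `singularSet` in `ℝ × ℂ`. -/
def allowedSet (Ω : DiscreteFilteredSet) : Set (ℝ × ℂ) :=
  (closure Ω.singularSet)ᶜ

/-- The length of the restriction of `γ` to `[0, t]` (finite when `γ` is Lipschitz there). -/
noncomputable def pathLength (γ : ℝ → ℂ) (t : ℝ) : ℝ :=
  (eVariationOn γ (Icc 0 t)).toReal

/-- The restriction of `γ` to `[0, T]` is an `Ω`-allowed path: it is a Lipschitz path starting
at `0` such that `(L(γ|[0,t]), γ(t))` stays in the allowed open set.
Only the values of `γ` on `[0, T]` matter. -/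
structure IsAllowedPath (Ω : DiscreteFilteredSet) (T : ℝ) (γ : ℝ → ℂ) : Prop where
  nonneg : 0 ≤ T
  lipschitz : ∃ K : ℝ≥0, LipschitzOnWith K γ (Icc 0 T)
  map_zero : γ 0 = 0
  allowed : ∀ t ∈ Icc (0 : ℝ) T, (pathLength γ t, γ t) ∈ Ω.allowedSet

end DiscreteFilteredSet

/-! ### Holomorphic germs and analytic continuation on one-dimensional complex manifolds -/

section Germs

variable {X : Type*} [TopologicalSpace X] [ChartedSpace ℂ X]
variable {Y : Type*} [TopologicalSpace Y] [ChartedSpace ℂ Y]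

/-- `f` is holomorphic on some neighbourhood of `x`. -/
def HolomorphicNear (f : X → ℂ) (x : X) : Prop :=
  ∀ᶠ y in 𝓝 x, MDifferentiableAt 𝓘(ℂ) 𝓘(ℂ) f y

variable (X) in
/-- The stalk at `x` of the sheaf of holomorphic functions on `X`. -/
def HolomorphicGerm (x : X) : Type _ :=
  {φ : Germ (𝓝 x) ℂ // ∃ f : X → ℂ, HolomorphicNear f x ∧ (f : Germ (𝓝 x) ℂ) = φ}

/-- The function `f` represents the germ `φ` at `x`. -/
def HolomorphicGerm.IsRepresentedBy {x : X} (φ : HolomorphicGerm X x) (f : X → ℂ) : Prop :=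
  (f : Germ (𝓝 x) ℂ) = φ.1

/-- The pullback of a holomorphic germ at `y` by a holomorphic map `p` with `p x = y`. -/
def HolomorphicGerm.pullback {p : X → Y} (hp : MDifferentiable 𝓘(ℂ) 𝓘(ℂ) p) {x : X} {y : Y}
    (hxy : p x = y) (φ : HolomorphicGerm Y y) : HolomorphicGerm X x :=
  have hlim : Tendsto p (𝓝 x) (𝓝 y) := hxy ▸ hp.continuous.continuousAt
  ⟨φ.1.compTendsto p hlim, by
    obtain ⟨_, f, hf, rfl⟩ := φ
    refine ⟨f ∘ p, ?_, rfl⟩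
    filter_upwards [hlim.eventually hf] with z hz
    exact hz.comp z (hp z)⟩

/-- The germ `φ` at `x` can be analytically continued along the path `γ : [0, T] → X`
(which is meant to be continuous, with `γ 0 = x`): there are holomorphic germs at the points
`γ t`, represented by functions `F t`, which start from `φ` and such that, for `s` close to `t`,
the germ at `γ s` is the one induced by the representative `F t` of the germ at `γ t`. -/
def HolomorphicGerm.ContinuesAlong {x : X} (φ : HolomorphicGerm X x) (T : ℝ) (γ : ℝ → X) :
    Prop :=
  ∃ F : ℝ → X → ℂ, φ.IsRepresentedBy (F 0) ∧
    ∀ t ∈ Icc (0 : ℝ) T, HolomorphicNear (F t) (γ t) ∧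
      ∀ᶠ s in 𝓝[Icc (0 : ℝ) T] t, F s =ᶠ[𝓝 (γ s)] F t

variable (X) in
/-- The global holomorphic functions on `X`. -/
def GlobalHolomorphic : Type _ := {f : X → ℂ // MDifferentiable 𝓘(ℂ) 𝓘(ℂ) f}

end Germs

namespace DiscreteFilteredSet

/-- A holomorphic germ at `0 ∈ ℂ` is `Ω`-continuable if it can be analytically continued along
every `Ω`-allowed path. -/
def IsContinuable (Ω : DiscreteFilteredSet) (φ : HolomorphicGerm ℂ 0) : Prop :=
  ∀ (T : ℝ) (γ : ℝ → ℂ), Ω.IsAllowedPath T γ → φ.ContinuesAlong T γ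

/-- The set of all `Ω`-continuable germs. -/
def ContinuableGerm (Ω : DiscreteFilteredSet) : Type :=
  {φ : HolomorphicGerm ℂ 0 // Ω.IsContinuable φ}

end DiscreteFilteredSet

/-! ### Endless Riemann surfaces -/

/-- An `Ω`-endless Riemann surface: a connected Riemann surface with a local biholomorphism to
`ℂ` and a base point over `0`, from which every `Ω`-allowed path `[0, 1] → ℂ` lifts.
Complex `C^1` maps are the holomorphic ones, so that the order of smoothness `1` gives complex
manifolds and local biholomorphisms. Second countability is not required, as it holds for every
connected Riemann surface. -/
structure EndlessRiemannSurface (Ω : DiscreteFilteredSet) where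
  /-- the underlying set -/
  carrier : Type
  [topology : TopologicalSpace carrier]
  [t2 : T2Space carrier]
  [connected : ConnectedSpace carrier]
  [charted : ChartedSpace ℂ carrier]
  [manifold : IsManifold 𝓘(ℂ) 1 carrier]
  /-- the projection to the complex plane -/
  proj : carrier → ℂ
  isLocalDiffeomorph_proj : IsLocalDiffeomorph 𝓘(ℂ) 𝓘(ℂ) 1 proj
  /-- the base point -/
  base : carrier
  proj_base : proj base = 0
  exists_lift : ∀ γ : ℝ → ℂ, Ω.IsAllowedPath 1 γ →
    ∃ γ' : ℝ → carrier, ContinuousOn γ' (Icc 0 1) ∧ γ' 0 = base ∧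
      ∀ t ∈ Icc (0 : ℝ) 1, proj (γ' t) = γ t

namespace EndlessRiemannSurface

attribute [instance] topology t2 connected charted manifold

variable {Ω : DiscreteFilteredSet}

/-- Morphisms of `Ω`-endless Riemann surfaces: local biholomorphisms that are compatible with
the projections and the base points. -/
structure IsMorphism (X Y : EndlessRiemannSurface Ω) (q : X.carrier → Y.carrier) : Prop where
  isLocalDiffeomorph : IsLocalDiffeomorph 𝓘(ℂ) 𝓘(ℂ) 1 q
  proj_comp : ∀ x, Y.proj (q x) = X.proj x
  map_base : q X.base = Y.base

/-- `X` is an initial object of the category of `Ω`-endless Riemann surfaces. -/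
def IsInitial (X : EndlessRiemannSurface Ω) : Prop :=
  ∀ Y : EndlessRiemannSurface Ω, ∃! q : X.carrier → Y.carrier, IsMorphism X Y q

theorem mdifferentiable_proj (X : EndlessRiemannSurface Ω) :
    MDifferentiable 𝓘(ℂ) 𝓘(ℂ) X.proj :=
  X.isLocalDiffeomorph_proj.mdifferentiable one_ne_zero

/-- The pullback by the projection of a germ at `0 ∈ ℂ` to a germ at the base point. -/
noncomputable def pullbackGerm (X : EndlessRiemannSurface Ω) (φ : HolomorphicGerm ℂ 0) :
    HolomorphicGerm X.carrier X.base :=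
  φ.pullback X.mdifferentiable_proj X.proj_base

end EndlessRiemannSurface

/-!
# The initial endless Riemann surface of a discrete filtered set

The argument avoids homotopies of allowed paths and the monodromy theorem; it rests on the
uniqueness of lifts and on the universal property.

*Existence.* A morphism sends the lift of an allowed path to the lift of the same path, so in an
initial object the end point of a lift must be determined by its end points in all endless
surfaces. Accordingly two allowed paths are identified when their lifts to every endless surface
have the same end point (`liftSetoid`), and the quotient `UniversalSpace` is made a space over `ℂ`
whose local sections append short segments to a path. That this works depends on one uniformity:
as the allowed set is open, segments to all points of a disc can be appended to an allowed path
(`IsAllowedPath.exists_appendSegment`), and the disc does not depend on the surface. Over it, the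
end points of the lifts form a continuous section of every endless surface `Y`
(`continuousOn_endpoint_extend`), and two such sections that meet agree
(`endpoint_extend_eq_of_eq`). Hence the quotient is a Hausdorff space with a local homeomorphism to
`ℂ`, the restrictions of a path `c` to `[0, t]` form a lift of `c`, and the end point of the lift to
`Y` is the unique morphism to `Y` (`isInitial_surface`).

*Continuable germs.* If `φ` is `Ω`-continuable, analytic continuation lifts the allowed paths to the
étale space `GermSpace` of the sheaf of holomorphic functions, which is Hausdorff by the identity
theorem. So the component of `φ` in it is an endless surface (`IsContinuable.surface`), and an
initial surface `X` maps to it. Composed with the evaluation of germs, this map is a global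
holomorphic function on `X` whose germ at the base point is the pullback of `φ`
(`IsInitial.exists_isRepresentedBy`). Conversely, a global function continues along every path,
and continuations along the lift of an allowed path descend to `ℂ`
(`isContinuable_of_forall_continuesAlong`). The bijection follows with the identity theorem on `X`
(`eq_of_eventuallyEq_base`), because every germ at the base point is a pullback.
-/

/-! ### Spaces spread over the plane -/

/-- A set `E` over `ℂ` in which every point `x` is equipped with a germ of section `sec x` of the
projection, such that the germs attached to nearby points of one section are induced by it.
This is the data that makes `E` an étale space over `ℂ`. -/
structure LocalSections {E : Type*} (p : E → ℂ) where
  /-- a section of `p` through `x`; only its germ at `p x` matters -/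
  sec : E → ℂ → E
  sec_self : ∀ x, sec x (p x) = x
  proj_sec : ∀ x, ∀ᶠ w in 𝓝 (p x), p (sec x w) = w
  sec_sec : ∀ x, ∀ᶠ w in 𝓝 (p x), ∀ᶠ w' in 𝓝 w, sec (sec x w) w' = sec x w'

namespace LocalSections

variable {E : Type*} {p : E → ℂ} (S : LocalSections p)

/-- The topology for which a set is open when it contains, with each point `x`, the values of the
section `sec x` near `p x`. -/
@[reducible] def topology : TopologicalSpace E where
  IsOpen s := ∀ x ∈ s, ∀ᶠ w in 𝓝 (p x), S.sec x w ∈ s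
  isOpen_univ _ _ := Eventually.of_forall fun _ ↦ mem_univ _
  isOpen_inter _ _ hs ht x hx := (hs x hx.1).and (ht x hx.2)
  isOpen_sUnion _ h x := by
    rintro ⟨s, hs, hx⟩
    exact (h s hs x hx).mono fun w hw ↦ ⟨s, hs, hw⟩

theorem isOpen_iff {s : Set E} :
    IsOpen[S.topology] s ↔ ∀ x ∈ s, ∀ᶠ w in 𝓝 (p x), S.sec x w ∈ s := Iff.rfl

theorem continuous_iff {F : Type*} [TopologicalSpace F] {f : E → F} :
    Continuous[S.topology, _] f ↔ ∀ x, Tendsto (fun w ↦ f (S.sec x w)) (𝓝 (p x)) (𝓝 (f x)) := by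
  let := S.topology
  constructor
  · intro hf x u hu
    obtain ⟨v, hvu, hv, hxv⟩ := mem_nhds_iff.1 hu
    exact mem_of_superset (S.isOpen_iff.1 (hv.preimage hf) x hxv) fun w hw ↦ hvu hw
  · intro h
    refine ⟨fun s hs ↦ S.isOpen_iff.2 fun x hx ↦ h x (hs.mem_nhds hx)⟩

theorem continuous_proj : Continuous[S.topology, _] p :=
  S.continuous_iff.2 fun x ↦ tendsto_id.congr' ((S.proj_sec x).mono fun _ h ↦ h.symm)

/-- The projection of every point has an open neighbourhood on which the section through it is a
coherent section of the projection. -/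
theorem exists_good_nhds (x : E) : ∃ U : Set ℂ, IsOpen U ∧ p x ∈ U ∧
    ∀ w ∈ U, p (S.sec x w) = w ∧ ∀ᶠ w' in 𝓝 w, S.sec (S.sec x w) w' = S.sec x w' := by
  obtain ⟨U, hU, hUo, hxU⟩ := mem_nhds_iff.1 ((S.proj_sec x).and (S.sec_sec x))
  exact ⟨U, hUo, hxU, fun w hw ↦ hU hw⟩

theorem isOpen_image_sec {x : E} {U : Set ℂ} (hU : IsOpen U)
    (h : ∀ w ∈ U, p (S.sec x w) = w ∧ ∀ᶠ w' in 𝓝 w, S.sec (S.sec x w) w' = S.sec x w') :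
    IsOpen[S.topology] (S.sec x '' U) := by
  rw [isOpen_iff]
  rintro _ ⟨w, hw, rfl⟩
  rw [(h w hw).1]
  filter_upwards [(h w hw).2, hU.mem_nhds hw] with w' h1 h2
  exact h1 ▸ mem_image_of_mem _ h2

theorem continuousOn_sec {x : E} {U : Set ℂ}
    (h : ∀ w ∈ U, p (S.sec x w) = w ∧ ∀ᶠ w' in 𝓝 w, S.sec (S.sec x w) w' = S.sec x w') :
    @ContinuousOn _ _ _ S.topology (S.sec x) U := by
  let := S.topology
  intro w hw
  refine ContinuousAt.continuousWithinAt fun s hs ↦ ?_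
  obtain ⟨v, hvs, hv, hwv⟩ := mem_nhds_iff.1 hs
  have := S.isOpen_iff.1 hv _ hwv
  rw [(h w hw).1] at this
  refine mem_map.2 ?_
  filter_upwards [this, (h w hw).2] with w' h1 h2
  exact hvs (h2 ▸ h1)

theorem continuousAt_sec (x : E) : @ContinuousAt _ _ _ S.topology (S.sec x) (p x) := by
  let := S.topology
  obtain ⟨U, hU, hxU, h⟩ := S.exists_good_nhds x
  exact (S.continuousOn_sec h).continuousAt (hU.mem_nhds hxU)

theorem isLocalHomeomorph : @IsLocalHomeomorph _ _ S.topology _ p := by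
  let := S.topology
  intro x
  obtain ⟨U, hU, hxU, h⟩ := S.exists_good_nhds x
  refine ⟨{ toFun := p, invFun := S.sec x, source := S.sec x '' U, target := U,
            map_source' := ?_, map_target' := fun w hw ↦ mem_image_of_mem _ hw,
            left_inv' := ?_, right_inv' := fun w hw ↦ (h w hw).1,
            open_source := S.isOpen_image_sec hU h, open_target := hU,
            continuousOn_toFun := S.continuous_proj.continuousOn,
            continuousOn_invFun := S.continuousOn_sec h }, ⟨p x, hxU, S.sec_self x⟩, rfl⟩
  · rintro _ ⟨w, hw, rfl⟩
    rwa [(h w hw).1]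
  · rintro _ ⟨w, hw, rfl⟩
    rw [(h w hw).1]

/-- The étale topology is Hausdorff when sections through two distinct points of a fibre do not
meet. -/
theorem t2Space
    (h : ∀ x y, p x = p y → (∃ᶠ w in 𝓝 (p x), S.sec x w = S.sec y w) → x = y) :
    @T2Space E S.topology := by
  let := S.topology
  refine ⟨fun x y hxy ↦ ?_⟩
  by_cases hp : p x = p y
  · obtain ⟨U, hU, hxU, hx⟩ := S.exists_good_nhds x
    obtain ⟨V, hV, hyV, hy⟩ := S.exists_good_nhds y
    have hne : ∀ᶠ w in 𝓝 (p x), S.sec x w ≠ S.sec y w :=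
      not_frequently.1 fun h' ↦ hxy (h x y hp h')
    obtain ⟨W, hW, hWo, hxW⟩ := mem_nhds_iff.1 hne
    refine ⟨S.sec x '' (U ∩ W), S.sec y '' (V ∩ W),
      S.isOpen_image_sec (hU.inter hWo) fun w hw ↦ hx w hw.1,
      S.isOpen_image_sec (hV.inter hWo) fun w hw ↦ hy w hw.1,
      ⟨p x, ⟨hxU, hxW⟩, S.sec_self x⟩, ⟨p y, ⟨hyV, hp ▸ hxW⟩, S.sec_self y⟩, ?_⟩
    rw [Set.disjoint_left]
    rintro _ ⟨w, hw, rfl⟩ ⟨w', hw', he⟩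
    have : w = w' := by rw [← (hx w hw.1).1, ← he, (hy w' hw'.1).1]
    subst this
    exact hW hw.2 he.symm
  · obtain ⟨u, v, hu, hv, hxu, hyv, huv⟩ := t2_separation hp
    exact ⟨p ⁻¹' u, p ⁻¹' v, hu.preimage S.continuous_proj, hv.preimage S.continuous_proj,
      hxu, hyv, huv.preimage p⟩

end LocalSections

/-! ### Complex structures over the plane -/

section Structure

variable {E : Type*} [TopologicalSpace E] {p : E → ℂ}

/-- The complex structure pulled back by a local homeomorphism `p` to `ℂ`: the charts are all the
local homeomorphisms that are restrictions of `p`. -/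
@[reducible] noncomputable def IsLocalHomeomorph.planeChartedSpace (hp : IsLocalHomeomorph p) :
    ChartedSpace ℂ E where
  atlas := {e | p = e}
  chartAt x := (hp x).choose
  mem_chart_source x := (hp x).choose_spec.1
  chart_mem_atlas x := (hp x).choose_spec.2

/-- The transition maps between restrictions of `p` are identities. -/
theorem IsLocalHomeomorph.isManifold_planeChartedSpace (hp : IsLocalHomeomorph p) :
    letI := hp.planeChartedSpace
    IsManifold 𝓘(ℂ) 1 E := by
  let := hp.planeChartedSpace
  refine isManifold_of_contDiffOn _ _ _ fun e e' he he' ↦ ?_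
  refine contDiffOn_id.congr fun w hw ↦ ?_
  have hw' : w ∈ e.target := by
    have := hw.1
    simp only [mfld_simps] at this
    exact this.1
  have h1 : e' (e.symm w) = e (e.symm w) := by
    rw [← show p = e' from he', ← show p = e from he]
  simpa [h1] using e.right_inv hw'

theorem IsLocalHomeomorph.isLocalDiffeomorph_planeChartedSpace (hp : IsLocalHomeomorph p) :
    letI := hp.planeChartedSpace
    IsLocalDiffeomorph 𝓘(ℂ) 𝓘(ℂ) 1 p := by
  let := hp.planeChartedSpace
  have := hp.isManifold_planeChartedSpace
  intro x
  refine ⟨{ toPartialEquiv := (chartAt ℂ x).toPartialEquiv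
            open_source := (chartAt ℂ x).open_source
            open_target := (chartAt ℂ x).open_target
            contMDiffOn_toFun := contMDiffOn_chart
            contMDiffOn_invFun := contMDiffOn_chart_symm }, mem_chart_source ℂ x, ?_⟩
  intro y _
  exact congrFun (hp x).choose_spec.2 y

end Structure

namespace EndlessRiemannSurface

variable {Ω : DiscreteFilteredSet}

/-- A connected Hausdorff space with a local homeomorphism to `ℂ` that lifts the allowed paths,
with the pulled back complex structure. -/
@[reducible] noncomputable def ofIsLocalHomeomorph (E : Type) [TopologicalSpace E] [T2Space E]
    [ConnectedSpace E] (p : E → ℂ) (hp : IsLocalHomeomorph p) (b : E) (hb : p b = 0)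
    (h : ∀ γ : ℝ → ℂ, Ω.IsAllowedPath 1 γ →
      ∃ γ' : ℝ → E, ContinuousOn γ' (Icc 0 1) ∧ γ' 0 = b ∧
        ∀ t ∈ Icc (0 : ℝ) 1, p (γ' t) = γ t) :
    EndlessRiemannSurface Ω :=
  letI := hp.planeChartedSpace
  haveI := hp.isManifold_planeChartedSpace
  { carrier := E
    proj := p
    isLocalDiffeomorph_proj := hp.isLocalDiffeomorph_planeChartedSpace
    base := b
    proj_base := hb
    exists_lift := h }

theorem isLocalHomeomorph_proj (Y : EndlessRiemannSurface Ω) : IsLocalHomeomorph Y.proj :=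
  Y.isLocalDiffeomorph_proj.isLocalHomeomorph

/-- Lifts to an endless Riemann surface over a connected set are determined by one value. -/
theorem eqOn_of_proj_eqOn (Y : EndlessRiemannSurface Ω) {A : Type*} [TopologicalSpace A]
    {s : Set A} (hs : IsPreconnected s) {g₁ g₂ : A → Y.carrier} (h₁ : ContinuousOn g₁ s)
    (h₂ : ContinuousOn g₂ s) (h : ∀ a ∈ s, Y.proj (g₁ a) = Y.proj (g₂ a)) {a : A} (ha : a ∈ s)
    (hga : g₁ a = g₂ a) : EqOn g₁ g₂ s :=
  (T2Space.isSeparatedMap Y.proj).eqOn_of_comp_eqOn Y.isLocalHomeomorph_proj.isLocallyInjective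
    hs h₁ h₂ h ha hga

/-- A continuous map over `ℂ` between endless Riemann surfaces is a local biholomorphism: locally
it is the composition of one projection with an inverse branch of the other one. -/
theorem isLocalDiffeomorph_of_continuous {X Y : EndlessRiemannSurface Ω}
    {q : X.carrier → Y.carrier} (hq : Continuous q) (h : ∀ x, Y.proj (q x) = X.proj x) :
    IsLocalDiffeomorph 𝓘(ℂ) 𝓘(ℂ) 1 q := by
  intro x
  obtain ⟨Φ, hxΦ, hΦ⟩ := X.isLocalDiffeomorph_proj x
  obtain ⟨Ψ, hxΨ, hΨ⟩ := Y.isLocalDiffeomorph_proj (q x)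
  have hs : IsOpen (q ⁻¹' Ψ.source) := Ψ.open_source.preimage hq
  let Θ : PartialDiffeomorph 𝓘(ℂ) 𝓘(ℂ) X.carrier ℂ 1 :=
    { __ := Φ.toOpenPartialHomeomorph.restrOpen _ hs
      contMDiffOn_toFun := Φ.contMDiffOn_toFun.mono inter_subset_left
      contMDiffOn_invFun := Φ.contMDiffOn_invFun.mono inter_subset_left }
  have key : ∀ y ∈ Φ.source, q y ∈ Ψ.source → Φ y = Ψ (q y) := fun y hy hqy ↦ by
    rw [← hΦ hy, ← hΨ hqy, h]
  refine ⟨Θ.trans Ψ.symm, ?_, ?_⟩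
  · refine ⟨⟨hxΦ, hxΨ⟩, ?_⟩
    change Φ x ∈ Ψ.target
    rw [key x hxΦ hxΨ]
    exact Ψ.map_source hxΨ
  · rintro y ⟨⟨hy, hqy⟩, -⟩
    change q y = Ψ.symm (Φ y)
    rw [key y hy hqy]
    exact (Ψ.left_inv hqy).symm

theorem isMorphism_of_continuous {X Y : EndlessRiemannSurface Ω}
    {q : X.carrier → Y.carrier} (hq : Continuous q) (h : ∀ x, Y.proj (q x) = X.proj x)
    (hb : q X.base = Y.base) : IsMorphism X Y q :=
  ⟨isLocalDiffeomorph_of_continuous hq h, h, hb⟩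

theorem IsMorphism.continuous {X Y : EndlessRiemannSurface Ω}
    {q : X.carrier → Y.carrier} (hq : IsMorphism X Y q) : Continuous q :=
  hq.isLocalDiffeomorph.contMDiff.continuous

theorem IsMorphism.eq {X Y : EndlessRiemannSurface Ω}
    {q₁ q₂ : X.carrier → Y.carrier} (h₁ : IsMorphism X Y q₁) (h₂ : IsMorphism X Y q₂) :
    q₁ = q₂ := by
  have := Y.eqOn_of_proj_eqOn isPreconnected_univ h₁.continuous.continuousOn
    h₂.continuous.continuousOn (fun a _ ↦ (h₁.proj_comp a).trans (h₂.proj_comp a).symm)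
    (mem_univ X.base) (h₁.map_base.trans h₂.map_base.symm)
  exact funext fun x ↦ this (mem_univ x)

end EndlessRiemannSurface

/-! ### Operations on allowed paths -/

namespace DiscreteFilteredSet

variable {Ω : DiscreteFilteredSet}

theorem isOpen_allowedSet (Ω : DiscreteFilteredSet) : IsOpen Ω.allowedSet :=
  isClosed_closure.isOpen_compl

/-- The origin is allowed because the members of small index are empty. -/
theorem zero_mem_allowedSet (Ω : DiscreteFilteredSet) : ((0 : ℝ), (0 : ℂ)) ∈ Ω.allowedSet := by
  obtain ⟨δ, hδ, hempty⟩ := Ω.exists_part_eq_empty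
  have hsub : Ω.singularSet ⊆ {q : ℝ × ℂ | (δ : ℝ) ≤ q.1} := by
    rintro ⟨l, w⟩ ⟨L, hL, hw⟩
    simp only at hL hw
    subst hL
    change (δ : ℝ) ≤ L
    by_contra! hlt
    have := Ω.mono L δ (by exact_mod_cast hlt.le) hw
    simp [hempty] at this
  have hcl : IsClosed {q : ℝ × ℂ | (δ : ℝ) ≤ q.1} := isClosed_le continuous_const continuous_fst
  intro hmem
  have : (δ : ℝ) ≤ 0 := closure_minimal hsub hcl hmem
  exact absurd hδ (not_lt.2 (by exact_mod_cast this))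

theorem pathLength_congr {γ γ' : ℝ → ℂ} {t : ℝ} (h : EqOn γ γ' (Icc 0 t)) :
    pathLength γ t = pathLength γ' t := by
  rw [pathLength, pathLength, eVariationOn.congr h]

theorem pathLength_comp_mul {γ : ℝ → ℂ} {a t : ℝ} (ha : 0 ≤ a) (ht : 0 ≤ t) :
    pathLength (fun s ↦ γ (a * s)) t = pathLength γ (a * t) := by
  have himg : (fun s ↦ a * s) '' Icc 0 t = Icc 0 (a * t) := by
    simpa using image_mul_left_Icc ha ht
  have := eVariationOn.comp_eq_of_monotoneOn γ (t := Icc 0 t) (fun s ↦ a * s)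
    fun x _ y _ hxy ↦ mul_le_mul_of_nonneg_left hxy ha
  rw [himg] at this
  rw [pathLength, pathLength, ← this]
  rfl

theorem isAllowedPath_zero (Ω : DiscreteFilteredSet) : Ω.IsAllowedPath 0 fun _ ↦ 0 where
  nonneg := le_rfl
  lipschitz := ⟨0, (LipschitzWith.const 0).lipschitzOnWith⟩
  map_zero := rfl
  allowed t _ := by
    have : pathLength (fun _ ↦ 0) t = 0 := by
      rw [pathLength, eVariationOn.constant_on, ENNReal.toReal_zero]
      rintro _ ⟨_, _, rfl⟩ _ ⟨_, _, rfl⟩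
      rfl
    simpa only [this] using Ω.zero_mem_allowedSet

namespace IsAllowedPath

variable {T : ℝ} {γ : ℝ → ℂ}

theorem continuousOn (h : Ω.IsAllowedPath T γ) : ContinuousOn γ (Icc 0 T) :=
  h.lipschitz.choose_spec.continuousOn

theorem mono (h : Ω.IsAllowedPath T γ) {t : ℝ} (ht : t ∈ Icc 0 T) : Ω.IsAllowedPath t γ where
  nonneg := ht.1
  lipschitz := ⟨_, h.lipschitz.choose_spec.mono (Icc_subset_Icc_right ht.2)⟩
  map_zero := h.map_zero
  allowed s hs := h.allowed s ⟨hs.1, hs.2.trans ht.2⟩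

/-- Linear reparametrisation by the unit interval. -/
theorem rescale (h : Ω.IsAllowedPath T γ) : Ω.IsAllowedPath 1 fun s ↦ γ (T * s) := by
  have hmem : ∀ s ∈ Icc (0 : ℝ) 1, T * s ∈ Icc 0 T := fun s hs ↦
    ⟨mul_nonneg h.nonneg hs.1, mul_le_of_le_one_right h.nonneg hs.2⟩
  obtain ⟨K, hK⟩ := h.lipschitz
  refine ⟨zero_le_one, ⟨K * T.toNNReal, ?_⟩, by simp [h.map_zero], fun t ht ↦ ?_⟩
  · refine LipschitzOnWith.of_dist_le_mul fun x hx y hy ↦ ?_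
    refine (hK.dist_le_mul _ (hmem x hx) _ (hmem y hy)).trans_eq ?_
    rw [NNReal.coe_mul, Real.coe_toNNReal _ h.nonneg, Real.dist_eq, Real.dist_eq, ← mul_sub,
      abs_mul, abs_of_nonneg h.nonneg, mul_assoc]
  · rw [pathLength_comp_mul h.nonneg ht.1]
    exact h.allowed _ (hmem t ht)

end IsAllowedPath

/-- The path `γ` on `[0, T]`, followed on `[T, T + 1]` by the segment from `γ T` to `w`. -/
noncomputable def appendSegment (T : ℝ) (γ : ℝ → ℂ) (w : ℂ) (t : ℝ) : ℂ :=
  γ (min t T) + (max (t - T) 0 : ℝ) • (w - γ T)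

theorem appendSegment_of_le {T : ℝ} {γ : ℝ → ℂ} {w : ℂ} {t : ℝ} (h : t ≤ T) :
    appendSegment T γ w t = γ t := by
  simp [appendSegment, h]

theorem appendSegment_add {T : ℝ} {γ : ℝ → ℂ} {w : ℂ} {t : ℝ} (h : 0 ≤ t) :
    appendSegment T γ w (T + t) = γ T + t • (w - γ T) := by
  simp [appendSegment, h]

/-- A short enough segment can be appended to an allowed path, since the length of the path and
its end point stay close to an allowed pair. -/
theorem IsAllowedPath.exists_appendSegment {T : ℝ} {γ : ℝ → ℂ} (h : Ω.IsAllowedPath T γ) :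
    ∃ r > 0, ∀ w ∈ Metric.ball (γ T) r, Ω.IsAllowedPath (T + 1) (appendSegment T γ w) := by
  have hT := h.nonneg
  obtain ⟨r, hr, hball⟩ := Metric.isOpen_iff.1 Ω.isOpen_allowedSet _
    (h.allowed T ⟨hT, le_rfl⟩)
  refine ⟨r, hr, fun w hw ↦ ?_⟩
  obtain ⟨K, hK⟩ := h.lipschitz
  have hmin : ∀ t ∈ Icc 0 (T + 1), min t T ∈ Icc 0 T := fun t ht ↦
    ⟨le_min ht.1 hT, min_le_right _ _⟩
  refine ⟨by linarith, ⟨K + ‖w - γ T‖₊, ?_⟩, ?_, fun t ht ↦ ?_⟩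
  · refine LipschitzOnWith.of_dist_le_mul fun x hx y hy ↦ ?_
    refine (dist_add_add_le _ _ _ _).trans ?_
    rw [NNReal.coe_add, add_mul]
    refine add_le_add ((hK.dist_le_mul _ (hmin x hx) _ (hmin y hy)).trans ?_) ?_
    · refine mul_le_mul_of_nonneg_left ?_ K.2
      exact abs_min_sub_min_le_max x T y T |>.trans (by simp [Real.dist_eq])
    · rw [dist_eq_norm, ← sub_smul, norm_smul, mul_comm, coe_nnnorm]
      refine mul_le_mul_of_nonneg_left ?_ (norm_nonneg _)
      exact abs_max_sub_max_le_max (x - T) 0 (y - T) 0 |>.trans (by simp [Real.dist_eq])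
  · rw [appendSegment_of_le hT, h.map_zero]
  · rcases le_total t T with htT | htT
    · rw [appendSegment_of_le htT, pathLength_congr
        fun s hs ↦ appendSegment_of_le (hs.2.trans htT)]
      exact h.allowed t ⟨ht.1, htT⟩
    · obtain ⟨τ, rfl⟩ : ∃ τ, t = T + τ := ⟨t - T, by ring⟩
      have hτ : 0 ≤ τ := by linarith
      have hτ1 : τ ≤ 1 := by linarith [ht.2]
      have hwr : ‖w - γ T‖ < r := by rwa [← dist_eq_norm]
      have hsmul : τ * ‖w - γ T‖ < r :=
        (mul_le_of_le_one_left (norm_nonneg _) hτ1).trans_lt hwr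
      -- an upper bound for the length of the appended segment suffices
      have hseg : eVariationOn (appendSegment T γ w) (Icc T (T + τ)) ≤
          ENNReal.ofReal (τ * ‖w - γ T‖) := by
        have hlip : LipschitzOnWith ‖w - γ T‖₊ (appendSegment T γ w) (Icc T (T + τ)) := by
          refine LipschitzOnWith.of_dist_le_mul fun x hx y hy ↦ ?_
          obtain ⟨a, rfl⟩ : ∃ a, x = T + a := ⟨x - T, by ring⟩
          obtain ⟨b, rfl⟩ : ∃ b, y = T + b := ⟨y - T, by ring⟩
          rw [appendSegment_add (by linarith [hx.1]), appendSegment_add (by linarith [hy.1]),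
            dist_add_left, dist_eq_norm, ← sub_smul, norm_smul, mul_comm, coe_nnnorm,
            dist_add_left, dist_eq_norm]
        refine (hlip.comp_eVariationOn_le (f := appendSegment T γ w) (g := id)
          (fun x hx ↦ hx)).trans_eq ?_
        rw [eVariationOn_id_Icc, ← enorm_eq_nnnorm, ← ofReal_norm,
          ← ENNReal.ofReal_mul (norm_nonneg _)]
        congr 1
        ring
      have hsum := eVariationOn.Icc_add_Icc (appendSegment T γ w) (s := univ) hT htT (mem_univ T)
      simp only [univ_inter] at hsum
      have hfin : BoundedVariationOn γ (Icc 0 T) := by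
        simpa using hK.locallyBoundedVariationOn 0 T ⟨le_rfl, hT⟩ ⟨hT, le_rfl⟩
      have hlen : pathLength (appendSegment T γ w) (T + τ) =
          pathLength γ T + (eVariationOn (appendSegment T γ w) (Icc T (T + τ))).toReal := by
        rw [pathLength, ← hsum, eVariationOn.congr (f := appendSegment T γ w) (g := γ)
          (fun s hs ↦ appendSegment_of_le hs.2), ENNReal.toReal_add hfin
          (hseg.trans_lt ENNReal.ofReal_lt_top).ne, pathLength]
      have hle : (eVariationOn (appendSegment T γ w) (Icc T (T + τ))).toReal ≤
          τ * ‖w - γ T‖ :=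
        ENNReal.toReal_le_of_le_ofReal (by positivity) hseg
      refine hball ?_
      rw [Metric.mem_ball, Prod.dist_eq, max_lt_iff]
      constructor
      · rw [hlen, Real.dist_eq, add_sub_cancel_left, abs_of_nonneg ENNReal.toReal_nonneg]
        exact hle.trans_lt hsmul
      · rw [appendSegment_add hτ, dist_eq_norm, add_sub_cancel_left, norm_smul, Real.norm_eq_abs,
          abs_of_nonneg hτ]
        exact hsmul

/-- An `Ω`-allowed path. -/
structure AllowedPath (Ω : DiscreteFilteredSet) where
  /-- the end of the parameter interval -/
  time : ℝ
  /-- the underlying function, whose values outside the parameter interval are irrelevant -/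
  path : ℝ → ℂ
  isAllowedPath : Ω.IsAllowedPath time path

namespace AllowedPath

/-- The end point. -/
def endpoint (c : Ω.AllowedPath) : ℂ := c.path c.time

theorem time_mem (c : Ω.AllowedPath) : c.time ∈ Icc 0 c.time :=
  ⟨c.isAllowedPath.nonneg, le_rfl⟩

/-- The trivial path. -/
def trivial (Ω : DiscreteFilteredSet) : Ω.AllowedPath :=
  ⟨0, fun _ ↦ 0, Ω.isAllowedPath_zero⟩

/-- The restriction of `c` to `[0, t]`, where `t` is replaced with the closest point of the
parameter interval. -/
noncomputable def restrict (c : Ω.AllowedPath) (t : ℝ) : Ω.AllowedPath :=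
  ⟨projIcc 0 c.time c.isAllowedPath.nonneg t, c.path,
    c.isAllowedPath.mono (projIcc 0 c.time c.isAllowedPath.nonneg t).2⟩

theorem time_restrict (c : Ω.AllowedPath) {t : ℝ} (ht : t ∈ Icc 0 c.time) :
    (c.restrict t).time = t :=
  congrArg Subtype.val (projIcc_of_mem c.isAllowedPath.nonneg ht)

theorem path_restrict (c : Ω.AllowedPath) (t : ℝ) : (c.restrict t).path = c.path := rfl

theorem endpoint_restrict (c : Ω.AllowedPath) {t : ℝ} (ht : t ∈ Icc 0 c.time) :
    (c.restrict t).endpoint = c.path t := by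
  rw [endpoint, time_restrict c ht, path_restrict]

open scoped Classical in
/-- The path `c` followed by the segment from its end point to `w`, if this is allowed; otherwise
the path `c`. -/
noncomputable def extend (c : Ω.AllowedPath) (w : ℂ) : Ω.AllowedPath :=
  if h : Ω.IsAllowedPath (c.time + 1) (appendSegment c.time c.path w) then
    ⟨c.time + 1, appendSegment c.time c.path w, h⟩ else c

/-- A radius within which segments can be appended to `c`. -/
noncomputable def radius (c : Ω.AllowedPath) : ℝ :=
  c.isAllowedPath.exists_appendSegment.choose

theorem radius_pos (c : Ω.AllowedPath) : 0 < c.radius :=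
  c.isAllowedPath.exists_appendSegment.choose_spec.1

/-- The disc about the end point that is covered by appending segments to `c`. -/
def disc (c : Ω.AllowedPath) : Set ℂ := Metric.ball c.endpoint c.radius

theorem isOpen_disc (c : Ω.AllowedPath) : IsOpen c.disc := Metric.isOpen_ball

theorem endpoint_mem_disc (c : Ω.AllowedPath) : c.endpoint ∈ c.disc :=
  Metric.mem_ball_self c.radius_pos

theorem disc_mem_nhds (c : Ω.AllowedPath) : c.disc ∈ 𝓝 c.endpoint :=
  c.isOpen_disc.mem_nhds c.endpoint_mem_disc

theorem convex_disc (c : Ω.AllowedPath) : Convex ℝ c.disc := convex_ball _ _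

theorem extend_eq (c : Ω.AllowedPath) {w : ℂ} (hw : w ∈ c.disc) :
    c.extend w = ⟨c.time + 1, appendSegment c.time c.path w,
      c.isAllowedPath.exists_appendSegment.choose_spec.2 w hw⟩ :=
  dif_pos _

theorem time_extend (c : Ω.AllowedPath) {w : ℂ} (hw : w ∈ c.disc) :
    (c.extend w).time = c.time + 1 := by
  rw [c.extend_eq hw]

theorem path_extend (c : Ω.AllowedPath) {w : ℂ} (hw : w ∈ c.disc) :
    (c.extend w).path = appendSegment c.time c.path w := by
  rw [c.extend_eq hw]

theorem endpoint_extend (c : Ω.AllowedPath) {w : ℂ} (hw : w ∈ c.disc) :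
    (c.extend w).endpoint = w := by
  rw [endpoint, c.time_extend hw, c.path_extend hw, appendSegment_add zero_le_one, one_smul,
    add_sub_cancel]

end AllowedPath

end DiscreteFilteredSet

/-! ### Lifts of allowed paths -/

namespace EndlessRiemannSurface

variable {Ω : DiscreteFilteredSet} (Y : EndlessRiemannSurface Ω)

open DiscreteFilteredSet

theorem exists_lift_of_isAllowedPath {T : ℝ} {γ : ℝ → ℂ} (h : Ω.IsAllowedPath T γ) :
    ∃ γ' : ℝ → Y.carrier, ContinuousOn γ' (Icc 0 T) ∧ γ' 0 = Y.base ∧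
      ∀ t ∈ Icc (0 : ℝ) T, Y.proj (γ' t) = γ t := by
  obtain ⟨γ', hc, h0, hp⟩ := Y.exists_lift _ h.rescale
  have hmem : ∀ t ∈ Icc 0 T, t / T ∈ Icc (0 : ℝ) 1 := fun t ht ↦
    ⟨div_nonneg ht.1 h.nonneg, div_le_one_of_le₀ ht.2 h.nonneg⟩
  refine ⟨fun t ↦ γ' (t / T), hc.comp (continuous_id.div_const T).continuousOn hmem,
    by simpa using h0, fun t ht ↦ ?_⟩
  rw [hp _ (hmem t ht), mul_div_cancel_of_imp']
  rintro rfl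
  exact le_antisymm ht.2 ht.1

/-- The lift of an allowed path from the base point. -/
noncomputable def lift (c : Ω.AllowedPath) : ℝ → Y.carrier :=
  (Y.exists_lift_of_isAllowedPath c.isAllowedPath).choose

theorem continuousOn_lift (c : Ω.AllowedPath) : ContinuousOn (Y.lift c) (Icc 0 c.time) :=
  (Y.exists_lift_of_isAllowedPath c.isAllowedPath).choose_spec.1

theorem lift_zero (c : Ω.AllowedPath) : Y.lift c 0 = Y.base :=
  (Y.exists_lift_of_isAllowedPath c.isAllowedPath).choose_spec.2.1

theorem proj_lift (c : Ω.AllowedPath) {t : ℝ} (ht : t ∈ Icc 0 c.time) :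
    Y.proj (Y.lift c t) = c.path t :=
  (Y.exists_lift_of_isAllowedPath c.isAllowedPath).choose_spec.2.2 t ht

/-- The end point of the lift of an allowed path. -/
noncomputable def endpoint (c : Ω.AllowedPath) : Y.carrier := Y.lift c c.time

theorem proj_endpoint (c : Ω.AllowedPath) : Y.proj (Y.endpoint c) = c.endpoint :=
  Y.proj_lift c c.time_mem

theorem eqOn_lift (c : Ω.AllowedPath) {T : ℝ} (hT : T ∈ Icc 0 c.time) {γ' : ℝ → Y.carrier}
    (hc : ContinuousOn γ' (Icc 0 T)) (h0 : γ' 0 = Y.base)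
    (hp : ∀ t ∈ Icc 0 T, Y.proj (γ' t) = c.path t) : EqOn (Y.lift c) γ' (Icc 0 T) :=
  Y.eqOn_of_proj_eqOn isPreconnected_Icc
    ((Y.continuousOn_lift c).mono (Icc_subset_Icc_right hT.2)) hc
    (fun t ht ↦ (Y.proj_lift c ⟨ht.1, ht.2.trans hT.2⟩).trans (hp t ht).symm)
    (left_mem_Icc.2 hT.1) ((Y.lift_zero c).trans h0.symm)

theorem endpoint_of_time_eq_zero (c : Ω.AllowedPath) (h : c.time = 0) :
    Y.endpoint c = Y.base := by
  rw [endpoint, h, lift_zero]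

/-- Allowed paths that agree on the parameter interval of the shorter one have lifts that agree
there. -/
theorem lift_eq_endpoint (c d : Ω.AllowedPath) (hdc : d.time ≤ c.time)
    (h : ∀ t ∈ Icc 0 d.time, c.path t = d.path t) : Y.lift c d.time = Y.endpoint d :=
  Y.eqOn_lift c ⟨d.isAllowedPath.nonneg, hdc⟩ (Y.continuousOn_lift d) (Y.lift_zero d)
    (fun t ht ↦ (Y.proj_lift d ht).trans (h t ht).symm) d.time_mem

theorem endpoint_restrict (c : Ω.AllowedPath) {t : ℝ} (ht : t ∈ Icc 0 c.time) :
    Y.endpoint (c.restrict t) = Y.lift c t := by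
  rw [← Y.lift_eq_endpoint c (c.restrict t) ?_ fun _ _ ↦ rfl, c.time_restrict ht]
  rw [c.time_restrict ht]
  exact ht.2

theorem lift_extend_time (c : Ω.AllowedPath) {w : ℂ} (hw : w ∈ c.disc) :
    Y.lift (c.extend w) c.time = Y.endpoint c := by
  refine Y.lift_eq_endpoint _ c ?_ fun t ht ↦ ?_
  · rw [c.time_extend hw]; linarith
  · rw [c.path_extend hw, appendSegment_of_le ht.2]

/-- Over the disc of an allowed path, the end points of the lifts of the extensions of the path
form a continuous section. It is obtained by lifting the contraction of the disc. -/
theorem continuousOn_endpoint_extend (c : Ω.AllowedPath) :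
    ContinuousOn (fun w ↦ Y.endpoint (c.extend w)) c.disc := by
  rw [continuousOn_iff_continuous_domRestrict]
  let f : C(unitInterval × c.disc, ℂ) :=
    ⟨fun q ↦ c.endpoint + (q.1 : ℝ) • ((q.2 : ℂ) - c.endpoint), by fun_prop⟩
  let g : unitInterval × c.disc → Y.carrier := fun q ↦ Y.lift (c.extend q.2) (c.time + q.1)
  have hmem : ∀ (t : unitInterval) (w : c.disc), c.time + t ∈ Icc 0 (c.extend w).time := by
    intro t w
    rw [c.time_extend w.2]
    exact ⟨add_nonneg c.isAllowedPath.nonneg t.2.1, by linarith [t.2.2]⟩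
  have hg : Continuous g := by
    refine Y.isLocalHomeomorph_proj.continuous_lift (T2Space.isSeparatedMap _) f ?_ ?_ ?_
    · funext ⟨t, w⟩
      change Y.proj (Y.lift (c.extend w) (c.time + t)) = _
      rw [Y.proj_lift _ (hmem t w), c.path_extend w.2, appendSegment_add t.2.1]
      rfl
    · have : (fun w : c.disc ↦ g (0, w)) = fun _ ↦ Y.endpoint c := by
        funext w
        change Y.lift (c.extend w) (c.time + ((0 : unitInterval) : ℝ)) = _
        rw [Icc.coe_zero, add_zero, Y.lift_extend_time c w.2]
      rw [this]
      exact continuous_const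
    · intro w
      exact (Y.continuousOn_lift (c.extend w)).comp_continuous (by fun_prop) fun t ↦ hmem t w
  have : (c.disc.domRestrict fun w ↦ Y.endpoint (c.extend w)) = fun w ↦ g (1, w) := by
    funext w
    change Y.lift _ _ = Y.lift (c.extend w) (c.time + ((1 : unitInterval) : ℝ))
    rw [c.time_extend w.2, Icc.coe_one]
  rw [this]
  exact hg.comp (by fun_prop)

theorem proj_endpoint_extend (c : Ω.AllowedPath) {w : ℂ} (hw : w ∈ c.disc) :
    Y.proj (Y.endpoint (c.extend w)) = w := by
  rw [proj_endpoint, c.endpoint_extend hw]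

theorem endpoint_extend_self (c : Ω.AllowedPath) :
    Y.endpoint (c.extend c.endpoint) = Y.endpoint c := by
  have hw := c.endpoint_mem_disc
  have hT : (0 : ℝ) ≤ c.time := c.isAllowedPath.nonneg
  have hT' : c.time ≤ (c.extend c.endpoint).time := by rw [c.time_extend hw]; linarith
  have key := Y.eqOn_of_proj_eqOn (isPreconnected_Icc (a := c.time) (b := c.time + 1))
    (g₁ := Y.lift (c.extend c.endpoint)) (g₂ := fun _ ↦ Y.endpoint c)
    ((Y.continuousOn_lift _).mono (by
      rw [c.time_extend hw]; exact Icc_subset_Icc_left hT)) continuousOn_const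
    (fun t ht ↦ ?_) (left_mem_Icc.2 (by linarith)) (Y.lift_extend_time c hw)
  · have := key (right_mem_Icc.2 (by linarith))
    rwa [endpoint, c.time_extend hw]
  · rw [Y.proj_lift _ (by rw [c.time_extend hw]; exact ⟨hT.trans ht.1, ht.2⟩), c.path_extend hw,
      proj_endpoint]
    obtain ⟨τ, rfl⟩ : ∃ τ, t = c.time + τ := ⟨t - c.time, by ring⟩
    rw [appendSegment_add (by linarith [ht.1])]
    simp [DiscreteFilteredSet.AllowedPath.endpoint]

/-- If extensions of two allowed paths by segments to one point have lifts with the same end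
point, then so do the extensions to every common point. -/
theorem endpoint_extend_eq_of_eq (c d : Ω.AllowedPath) {w₀ w : ℂ} (hc₀ : w₀ ∈ c.disc)
    (hd₀ : w₀ ∈ d.disc) (h : Y.endpoint (c.extend w₀) = Y.endpoint (d.extend w₀))
    (hc : w ∈ c.disc) (hd : w ∈ d.disc) :
    Y.endpoint (c.extend w) = Y.endpoint (d.extend w) :=
  Y.eqOn_of_proj_eqOn (c.convex_disc.inter d.convex_disc).isPreconnected
    ((Y.continuousOn_endpoint_extend c).mono inter_subset_left)
    ((Y.continuousOn_endpoint_extend d).mono inter_subset_right)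
    (fun _ hw ↦ (Y.proj_endpoint_extend c hw.1).trans (Y.proj_endpoint_extend d hw.2).symm)
    ⟨hc₀, hd₀⟩ h ⟨hc, hd⟩

end EndlessRiemannSurface

/-! ### The universal endless Riemann surface -/

namespace DiscreteFilteredSet

variable {Ω : DiscreteFilteredSet}

variable (Ω) in
/-- Two allowed paths are identified when they have the same end point and when, in every
`Ω`-endless Riemann surface, their lifts have the same end point. -/
def liftSetoid : Setoid Ω.AllowedPath where
  r c d := c.endpoint = d.endpoint ∧
    ∀ Y : EndlessRiemannSurface Ω, Y.endpoint c = Y.endpoint d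
  iseqv := ⟨fun _ ↦ ⟨rfl, fun _ ↦ rfl⟩, fun h ↦ ⟨h.1.symm, fun Y ↦ (h.2 Y).symm⟩,
    fun h h' ↦ ⟨h.1.trans h'.1, fun Y ↦ (h.2 Y).trans (h'.2 Y)⟩⟩

variable (Ω) in
/-- The points of the universal `Ω`-endless Riemann surface: the allowed paths modulo `liftSetoid`.
It is the set of the families of end points of lifts of one allowed path to all `Ω`-endless
Riemann surfaces, presented as a quotient in order to be a small type. -/
def UniversalSpace : Type := Quotient Ω.liftSetoid

namespace UniversalSpace

/-- The class of an allowed path. -/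
def mk (c : Ω.AllowedPath) : Ω.UniversalSpace := Quotient.mk Ω.liftSetoid c

theorem mk_eq_mk {c d : Ω.AllowedPath} : mk c = mk d ↔
    c.endpoint = d.endpoint ∧ ∀ Y : EndlessRiemannSurface Ω, Y.endpoint c = Y.endpoint d :=
  Quotient.eq (r := Ω.liftSetoid)

/-- An allowed path in a given class. -/
noncomputable def out (x : Ω.UniversalSpace) : Ω.AllowedPath := Quotient.out x

@[simp] theorem mk_out (x : Ω.UniversalSpace) : mk x.out = x := Quotient.out_eq x

/-- The projection to the plane, that is, the end point of a path. -/
noncomputable def proj (x : Ω.UniversalSpace) : ℂ := x.out.endpoint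

theorem proj_mk (c : Ω.AllowedPath) : proj (mk c) = c.endpoint :=
  (mk_eq_mk.1 (mk_out (mk c))).1

/-- The projection to an endless Riemann surface: the end point of the lift of a path. -/
noncomputable def toSurface (Y : EndlessRiemannSurface Ω) (x : Ω.UniversalSpace) : Y.carrier :=
  Y.endpoint x.out

theorem toSurface_mk (Y : EndlessRiemannSurface Ω) (c : Ω.AllowedPath) :
    toSurface Y (mk c) = Y.endpoint c :=
  (mk_eq_mk.1 (mk_out (mk c))).2 Y

theorem ext_iff {x y : Ω.UniversalSpace} :
    x = y ↔ proj x = proj y ∧ ∀ Y, toSurface Y x = toSurface Y y := by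
  conv_lhs => rw [← mk_out x, ← mk_out y, mk_eq_mk]
  exact Iff.rfl

variable (Ω) in
/-- The sections of the projection obtained by appending segments to paths. The disc on which they
behave well depends only on a path, and not on the surfaces to which it is lifted. -/
noncomputable def localSections : LocalSections (proj (Ω := Ω)) where
  sec x w := mk (x.out.extend w)
  sec_self x := by
    conv_rhs => rw [← mk_out x]
    exact mk_eq_mk.2 ⟨x.out.endpoint_extend x.out.endpoint_mem_disc,
      fun Y ↦ Y.endpoint_extend_self x.out⟩
  proj_sec x := by
    filter_upwards [x.out.disc_mem_nhds] with w hw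
    rw [proj_mk, x.out.endpoint_extend hw]
  sec_sec x := by
    filter_upwards [x.out.disc_mem_nhds] with w hw
    set d := (mk (x.out.extend w)).out with hd
    obtain ⟨hend, hlift⟩ := mk_eq_mk.1 (mk_out (mk (x.out.extend w)))
    rw [x.out.endpoint_extend hw] at hend
    have hwd : w ∈ d.disc := by
      have := d.endpoint_mem_disc
      rwa [hd, hend] at this
    filter_upwards [d.isOpen_disc.mem_nhds hwd, x.out.isOpen_disc.mem_nhds hw] with w' h1 h2
    refine mk_eq_mk.2 ⟨by rw [d.endpoint_extend h1, x.out.endpoint_extend h2], fun Y ↦ ?_⟩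
    refine Y.endpoint_extend_eq_of_eq d x.out hwd hw ?_ h1 h2
    rw [← hlift Y]
    have := Y.endpoint_extend_self d
    rwa [show d.endpoint = w from hend] at this

theorem sec_eq (x : Ω.UniversalSpace) (w : ℂ) : (localSections Ω).sec x w = mk (x.out.extend w) :=
  rfl

noncomputable instance : TopologicalSpace Ω.UniversalSpace := (localSections Ω).topology

theorem isLocalHomeomorph_proj : IsLocalHomeomorph (proj (Ω := Ω)) :=
  (localSections Ω).isLocalHomeomorph

/-- Two distinct points over the same point of the plane are separated by some endless Riemann
surface, in which sections through distinct points do not meet. -/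
instance : T2Space Ω.UniversalSpace := by
  refine (localSections Ω).t2Space fun x y hp hfreq ↦ ?_
  have hdisc : ∀ᶠ w in 𝓝 (proj x), w ∈ x.out.disc ∩ y.out.disc :=
    inter_mem x.out.disc_mem_nhds (hp ▸ y.out.disc_mem_nhds)
  obtain ⟨w, hw, hx, hy⟩ := (hfreq.and_eventually hdisc).exists
  refine ext_iff.2 ⟨hp, fun Y ↦ ?_⟩
  have key := Y.endpoint_extend_eq_of_eq x.out y.out hx hy ((mk_eq_mk.1 hw).2 Y)
    x.out.endpoint_mem_disc
    (show proj x ∈ y.out.disc from hp ▸ y.out.endpoint_mem_disc)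
  rw [Y.endpoint_extend_self, show x.out.endpoint = y.out.endpoint from hp,
    Y.endpoint_extend_self] at key
  exact key

theorem continuous_toSurface (Y : EndlessRiemannSurface Ω) : Continuous (toSurface Y) := by
  refine (localSections Ω).continuous_iff.2 fun x ↦ ?_
  have := ((Y.continuousOn_endpoint_extend x.out).continuousAt x.out.disc_mem_nhds).tendsto
  rw [Y.endpoint_extend_self] at this
  simp only [sec_eq, toSurface_mk]
  exact this

/-- The restrictions of an allowed path form its lift to the universal space. -/
theorem continuousOn_mk_restrict (c : Ω.AllowedPath) :
    ContinuousOn (fun t ↦ mk (c.restrict t)) (Icc 0 c.time) := by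
  intro t ht
  set x := mk (c.restrict t) with hx
  obtain ⟨hend, hlift⟩ := mk_eq_mk.1 (mk_out x)
  rw [c.endpoint_restrict ht] at hend
  have hpx : proj x = c.path t := hend
  have hc := c.isAllowedPath.continuousOn t ht
  have hdisc : x.out.disc ∈ 𝓝 (c.path t) := hend ▸ x.out.disc_mem_nhds
  obtain ⟨ε, hε, hball⟩ := Metric.mem_nhdsWithin_iff.1 (hc hdisc)
  have hconv : IsPreconnected (Metric.ball t ε ∩ Icc 0 c.time) :=
    ((convex_ball t ε).inter (convex_Icc 0 c.time)).isPreconnected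
  have htend : Tendsto (fun s ↦ (localSections Ω).sec x (c.path s)) (𝓝[Icc 0 c.time] t) (𝓝 x) := by
    have h1 := ((localSections Ω).continuousAt_sec x).tendsto
    rw [(localSections Ω).sec_self, hpx] at h1
    exact h1.comp hc
  refine htend.congr' ?_
  filter_upwards [inter_mem_nhdsWithin (Icc 0 c.time) (Metric.ball_mem_nhds t hε)] with s hs
  have hs' : s ∈ Metric.ball t ε ∩ Icc 0 c.time := hs.symm
  refine mk_eq_mk.2 ⟨?_, fun Y ↦ ?_⟩
  · rw [x.out.endpoint_extend (hball hs'), c.endpoint_restrict hs.1]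
  rw [Y.endpoint_restrict c hs.1]
  refine Y.eqOn_of_proj_eqOn hconv (g₁ := fun s ↦ Y.endpoint (x.out.extend (c.path s)))
    ((Y.continuousOn_endpoint_extend x.out).comp
      (c.isAllowedPath.continuousOn.mono inter_subset_right) hball)
    ((Y.continuousOn_lift c).mono inter_subset_right) (fun u hu ↦ ?_)
    (a := t) ⟨Metric.mem_ball_self hε, ht⟩ ?_ hs'
  · rw [Y.proj_endpoint_extend _ (hball hu), Y.proj_lift c hu.2]
  · rw [← hend, Y.endpoint_extend_self, hlift Y, Y.endpoint_restrict c ht]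

/-- The class of the trivial path. -/
noncomputable def base (Ω : DiscreteFilteredSet) : Ω.UniversalSpace := mk (AllowedPath.trivial Ω)

theorem mk_restrict_zero (c : Ω.AllowedPath) : mk (c.restrict 0) = base Ω := by
  have h0 : (0 : ℝ) ∈ Icc 0 c.time := ⟨le_rfl, c.isAllowedPath.nonneg⟩
  refine mk_eq_mk.2 ⟨?_, fun Y ↦ ?_⟩
  · rw [c.endpoint_restrict h0, c.isAllowedPath.map_zero]
    rfl
  · rw [Y.endpoint_restrict c h0, Y.lift_zero, Y.endpoint_of_time_eq_zero _ rfl]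

theorem mk_restrict_time (c : Ω.AllowedPath) : mk (c.restrict c.time) = mk c :=
  mk_eq_mk.2 ⟨c.endpoint_restrict c.time_mem, fun Y ↦ Y.endpoint_restrict c c.time_mem⟩

instance : ConnectedSpace Ω.UniversalSpace where
  toNonempty := ⟨base Ω⟩
  isPreconnected_univ := by
    refine isPreconnected_of_forall (base Ω) fun x _ ↦ ?_
    refine ⟨(fun t ↦ mk (x.out.restrict t)) '' Icc 0 x.out.time, subset_univ _,
      ⟨0, ⟨le_rfl, x.out.isAllowedPath.nonneg⟩, mk_restrict_zero _⟩,
      ⟨x.out.time, x.out.time_mem, ?_⟩,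
      isPreconnected_Icc.image _ (continuousOn_mk_restrict x.out)⟩
    simp only [mk_restrict_time, mk_out]

theorem proj_base : proj (base Ω) = 0 := proj_mk _

variable (Ω) in
/-- The universal space as an `Ω`-endless Riemann surface. -/
noncomputable def surface : EndlessRiemannSurface Ω :=
  .ofIsLocalHomeomorph Ω.UniversalSpace proj isLocalHomeomorph_proj (base Ω) proj_base
    fun γ hγ ↦ by
      let c : Ω.AllowedPath := ⟨1, γ, hγ⟩
      refine ⟨fun t ↦ mk (c.restrict t), continuousOn_mk_restrict c, mk_restrict_zero c,
        fun t ht ↦ ?_⟩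
      rw [proj_mk]
      exact c.endpoint_restrict ht

theorem isMorphism_toSurface (Y : EndlessRiemannSurface Ω) :
    EndlessRiemannSurface.IsMorphism (surface Ω) Y (toSurface Y) :=
  EndlessRiemannSurface.isMorphism_of_continuous (X := surface Ω) (continuous_toSurface Y)
    (fun x ↦ Y.proj_endpoint x.out)
    ((toSurface_mk Y _).trans (Y.endpoint_of_time_eq_zero _ rfl))

theorem isInitial_surface : (surface Ω).IsInitial := fun Y ↦
  ⟨toSurface Y, isMorphism_toSurface Y, fun _ h ↦ h.eq (isMorphism_toSurface Y)⟩

end UniversalSpace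

end DiscreteFilteredSet

/-! ### Holomorphic germs and the étale space of the sheaf of holomorphic functions -/

section HolomorphicNear

variable {X : Type*} [TopologicalSpace X] [ChartedSpace ℂ X]

theorem HolomorphicNear.eventually {f : X → ℂ} {x : X} (h : HolomorphicNear f x) :
    ∀ᶠ y in 𝓝 x, HolomorphicNear f y :=
  eventually_eventually_nhds.2 h

theorem HolomorphicNear.analyticAt {f : ℂ → ℂ} {z : ℂ} (h : HolomorphicNear f z) :
    AnalyticAt ℂ f z :=
  Complex.analyticAt_iff_eventually_differentiableAt.2 <|
    h.mono fun _ ↦ mdifferentiableAt_iff_differentiableAt.1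

/-- The identity theorem for germs of holomorphic functions. -/
theorem HolomorphicNear.eventuallyEq_of_frequently {f g : ℂ → ℂ} {z : ℂ}
    (hf : HolomorphicNear f z) (hg : HolomorphicNear g z)
    (h : ∃ᶠ w in 𝓝 z, f =ᶠ[𝓝 w] g) : f =ᶠ[𝓝 z] g := by
  refine (hf.analyticAt.eventually_eq_or_eventually_ne hg.analyticAt).resolve_right fun hne ↦ h ?_
  filter_upwards [eventually_eventually_nhds.2 (eventually_nhdsWithin_iff.1 hne)] with w hw heq
  -- near `w` the functions differ except perhaps at `z`, but a punctured disc is not empty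
  have hz : ∀ᶠ u in 𝓝[≠] w, u = z := by
    refine eventually_nhdsWithin_of_eventually_nhds ?_
    filter_upwards [hw, heq] with u h1 h2
    by_contra hu
    exact h1 hu h2
  have hz' : ∀ᶠ u in 𝓝[≠] w, u ≠ z := by
    rcases eq_or_ne w z with rfl | hwz
    · exact eventually_mem_nhdsWithin
    · exact eventually_nhdsWithin_of_eventually_nhds (isOpen_ne.mem_nhds hwz)
  obtain ⟨u, h1, h2⟩ := (hz.and hz').exists
  exact h2 h1

end HolomorphicNear

/-- The étale space of the sheaf of holomorphic functions on `ℂ`: the set of all pairs of a point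
and a germ of holomorphic function at that point. -/
structure GermSpace where
  /-- the point -/
  point : ℂ
  /-- the germ -/
  germ : HolomorphicGerm ℂ point

namespace GermSpace

/-- A function that represents the germ. -/
noncomputable def rep (x : GermSpace) : ℂ → ℂ := x.germ.2.choose

theorem holomorphicNear_rep (x : GermSpace) : HolomorphicNear x.rep x.point :=
  x.germ.2.choose_spec.1

theorem coe_rep (x : GermSpace) : (x.rep : Germ (𝓝 x.point) ℂ) = x.germ.1 :=
  x.germ.2.choose_spec.2

open scoped Classical in
/-- The germ of `f` at `z`, or the germ `0` when `f` is not holomorphic near `z`. -/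
noncomputable def ofFun (f : ℂ → ℂ) (z : ℂ) : GermSpace :=
  if h : HolomorphicNear f z then ⟨z, f, f, h, rfl⟩
  else ⟨z, (fun _ ↦ 0 : ℂ → ℂ), fun _ ↦ 0, Eventually.of_forall fun _ ↦ mdifferentiableAt_const,
    rfl⟩

theorem point_ofFun (f : ℂ → ℂ) (z : ℂ) : (ofFun f z).point = z := by
  unfold ofFun
  split_ifs <;> rfl

theorem ofFun_of_holomorphicNear {f : ℂ → ℂ} {z : ℂ} (h : HolomorphicNear f z) :
    ofFun f z = ⟨z, f, f, h, rfl⟩ :=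
  dif_pos h

theorem ofFun_eq_ofFun {f g : ℂ → ℂ} {z : ℂ} (hf : HolomorphicNear f z)
    (hg : HolomorphicNear g z) : ofFun f z = ofFun g z ↔ f =ᶠ[𝓝 z] g := by
  rw [ofFun_of_holomorphicNear hf, ofFun_of_holomorphicNear hg]
  exact ⟨fun h ↦ Germ.coe_eq.1 (congrArg Subtype.val (eq_of_heq (GermSpace.mk.inj h).2)),
    fun h ↦ congrArg (GermSpace.mk z) (Subtype.ext (Germ.coe_eq.2 h))⟩

theorem ofFun_rep (x : GermSpace) : ofFun x.rep x.point = x := by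
  rw [ofFun_of_holomorphicNear x.holomorphicNear_rep]
  obtain ⟨z, φ⟩ := x
  congr 1
  exact Subtype.ext (coe_rep ⟨z, φ⟩)

theorem rep_ofFun {f : ℂ → ℂ} {z : ℂ} (hf : HolomorphicNear f z) :
    (ofFun f z).rep =ᶠ[𝓝 z] f := by
  have h := (ofFun f z).holomorphicNear_rep
  rw [point_ofFun] at h
  rw [← ofFun_eq_ofFun h hf]
  conv_rhs => rw [← ofFun_rep (ofFun f z), point_ofFun]

/-- The sections of the étale space given by holomorphic functions. -/
noncomputable def localSections : LocalSections GermSpace.point where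
  sec x := ofFun x.rep
  sec_self := ofFun_rep
  proj_sec x := Eventually.of_forall fun w ↦ point_ofFun _ _
  sec_sec x := by
    filter_upwards [x.holomorphicNear_rep.eventually] with w hw
    have h := (ofFun x.rep w).holomorphicNear_rep
    rw [point_ofFun] at h
    filter_upwards [h.eventually, hw.eventually, eventually_eventually_nhds.2 (rep_ofFun hw)]
      with w' h1 h2 h3
    exact (ofFun_eq_ofFun h1 h2).2 h3

noncomputable instance : TopologicalSpace GermSpace := localSections.topology

theorem isLocalHomeomorph_point : IsLocalHomeomorph GermSpace.point :=
  localSections.isLocalHomeomorph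

instance : T2Space GermSpace := by
  refine localSections.t2Space fun x y hp hfreq ↦ ?_
  have hx := x.holomorphicNear_rep
  have hy := y.holomorphicNear_rep
  rw [← hp] at hy
  rw [← ofFun_rep x, ← ofFun_rep y, ← hp, ofFun_eq_ofFun hx hy]
  refine hx.eventuallyEq_of_frequently hy ?_
  refine (hfreq.and_eventually (hx.eventually.and hy.eventually)).mono fun w hw ↦ ?_
  exact (ofFun_eq_ofFun hw.2.1 hw.2.2).1 hw.1

theorem continuousAt_ofFun {f : ℂ → ℂ} {z : ℂ} (hf : HolomorphicNear f z) :
    ContinuousAt (ofFun f) z := by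
  have h := localSections.continuousAt_sec (ofFun f z)
  rw [point_ofFun] at h
  have hr := (ofFun f z).holomorphicNear_rep
  rw [point_ofFun] at hr
  refine h.congr ?_
  filter_upwards [hf.eventually, hr.eventually, eventually_eventually_nhds.2 (rep_ofFun hf)]
    with w h1 h2 h3
  exact (ofFun_eq_ofFun h2 h1).2 h3

/-- Near a point of the étale space, all germs are induced by one holomorphic function. -/
theorem eventually_eq_ofFun (x : GermSpace) : ∀ᶠ y in 𝓝 x, y = ofFun x.rep y.point := by
  obtain ⟨U, hU, hxU, h⟩ := localSections.exists_good_nhds x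
  filter_upwards [(localSections.isOpen_image_sec hU h).mem_nhds
    ⟨x.point, hxU, localSections.sec_self x⟩]
  rintro _ ⟨w, hw, rfl⟩
  rw [(h w hw).1]
  rfl

/-- The value of a germ. -/
noncomputable def value (x : GermSpace) : ℂ := x.rep x.point

theorem value_ofFun {f : ℂ → ℂ} {z : ℂ} (hf : HolomorphicNear f z) : value (ofFun f z) = f z := by
  rw [value, point_ofFun]
  exact (rep_ofFun hf).self_of_nhds

theorem value_eventuallyEq (x : GermSpace) : ∀ᶠ y in 𝓝 x, value y = x.rep y.point := by
  filter_upwards [x.eventually_eq_ofFun,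
    isLocalHomeomorph_point.continuous.continuousAt.eventually x.holomorphicNear_rep.eventually]
    with y h1 h2
  conv_lhs => rw [h1, value_ofFun h2]

theorem isOpen_connectedComponent (x : GermSpace) : IsOpen (connectedComponent x) :=
  let := isLocalHomeomorph_point.planeChartedSpace
  have := ChartedSpace.locallyConnectedSpace ℂ GermSpace
  _root_.isOpen_connectedComponent

/-- Analytic continuation along a path is a lift of the path to the étale space. -/
theorem continuousOn_ofFun {T : ℝ} {γ : ℝ → ℂ} (hγ : ContinuousOn γ (Icc 0 T)) {F : ℝ → ℂ → ℂ}
    (hF : ∀ t ∈ Icc (0 : ℝ) T, HolomorphicNear (F t) (γ t) ∧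
      ∀ᶠ s in 𝓝[Icc (0 : ℝ) T] t, F s =ᶠ[𝓝 (γ s)] F t) :
    ContinuousOn (fun t ↦ ofFun (F t) (γ t)) (Icc 0 T) := by
  intro t ht
  have h1 : ContinuousWithinAt (fun s ↦ ofFun (F t) (γ s)) (Icc 0 T) t :=
    (continuousAt_ofFun (hF t ht).1).comp_continuousWithinAt (hγ t ht)
  refine h1.congr_of_eventuallyEq ?_ rfl
  filter_upwards [(hF t ht).2, self_mem_nhdsWithin,
    (hγ t ht).eventually (hF t ht).1.eventually] with s h2 hs h3
  exact (ofFun_eq_ofFun (hF s hs).1 h3).2 h2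

end GermSpace

namespace DiscreteFilteredSet.IsContinuable

variable {Ω : DiscreteFilteredSet} {φ : HolomorphicGerm ℂ 0}

theorem exists_lift (h : Ω.IsContinuable φ) {γ : ℝ → ℂ} (hγ : Ω.IsAllowedPath 1 γ) :
    ∃ γ' : ℝ → connectedComponent (⟨0, φ⟩ : GermSpace), ContinuousOn γ' (Icc 0 1) ∧
      γ' 0 = ⟨⟨0, φ⟩, mem_connectedComponent⟩ ∧
        ∀ t ∈ Icc (0 : ℝ) 1, (γ' t).1.point = γ t := by
  obtain ⟨F, hF0, hF⟩ := h 1 γ hγ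
  set G : ℝ → GermSpace := fun t ↦ GermSpace.ofFun (F t) (γ t) with hG
  have hc : ContinuousOn G (Icc 0 1) := GermSpace.continuousOn_ofFun hγ.continuousOn hF
  have h0 : (0 : ℝ) ∈ Icc (0 : ℝ) 1 := ⟨le_rfl, zero_le_one⟩
  have hG0 : G 0 = ⟨0, φ⟩ := by
    have h1 := (hF 0 h0).1
    rw [hγ.map_zero] at h1
    rw [hG]
    simp only
    rw [hγ.map_zero, GermSpace.ofFun_of_holomorphicNear h1]
    congr 1
    exact Subtype.ext hF0
  have hmem : ∀ t ∈ Icc (0 : ℝ) 1, G t ∈ connectedComponent (⟨0, φ⟩ : GermSpace) := fun t ht ↦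
    (isPreconnected_Icc.image _ hc).subset_connectedComponent ⟨0, h0, hG0⟩ ⟨t, ht, rfl⟩
  refine ⟨fun t ↦ ⟨G (projIcc 0 1 zero_le_one t), hmem _ (projIcc 0 1 zero_le_one t).2⟩,
    ?_, ?_, fun t ht ↦ ?_⟩
  · refine Continuous.continuousOn (Continuous.subtype_mk ?_ _)
    exact hc.comp_continuous (continuous_subtype_val.comp continuous_projIcc) fun t ↦
      (projIcc 0 1 zero_le_one t).2
  · refine Subtype.ext ?_
    simp only [projIcc_of_mem zero_le_one h0]
    exact hG0
  · simp only [projIcc_of_mem zero_le_one ht]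
    exact GermSpace.point_ofFun _ _

/-- The endless Riemann surface of a continuable germ: the set of all germs that can be reached
from it in the étale space of the sheaf of holomorphic functions. -/
noncomputable def surface (h : Ω.IsContinuable φ) : EndlessRiemannSurface Ω :=
  have : ConnectedSpace (connectedComponent (⟨0, φ⟩ : GermSpace)) :=
    isConnected_iff_connectedSpace.1 isConnected_connectedComponent
  .ofIsLocalHomeomorph (connectedComponent (⟨0, φ⟩ : GermSpace)) (fun x ↦ x.1.point)
    (GermSpace.isLocalHomeomorph_point.comp
      (GermSpace.isOpen_connectedComponent _).isOpenEmbedding_subtypeVal.isLocalHomeomorph)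
    ⟨⟨0, φ⟩, mem_connectedComponent⟩ rfl fun _ ↦ h.exists_lift

end DiscreteFilteredSet.IsContinuable

/-! ### Germs on endless Riemann surfaces -/

namespace EndlessRiemannSurface

variable {Ω : DiscreteFilteredSet} (X : EndlessRiemannSurface Ω)

theorem eventuallyEq_comp_proj {x : X.carrier} {f g : ℂ → ℂ} :
    f ∘ X.proj =ᶠ[𝓝 x] g ∘ X.proj ↔ f =ᶠ[𝓝 (X.proj x)] g := by
  rw [← X.isLocalHomeomorph_proj.map_nhds_eq x]
  exact Iff.rfl

theorem pullbackGerm_isRepresentedBy {φ : HolomorphicGerm ℂ 0} {f : ℂ → ℂ}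
    (hf : φ.IsRepresentedBy f) {g : X.carrier → ℂ} :
    (X.pullbackGerm φ).IsRepresentedBy g ↔ g =ᶠ[𝓝 X.base] f ∘ X.proj := by
  obtain ⟨_, hφ⟩ := φ
  obtain rfl := hf
  exact Germ.coe_eq

/-- Every germ of holomorphic function on `X` descends by the projection. -/
theorem exists_descend {x : X.carrier} {F : X.carrier → ℂ} (hF : HolomorphicNear F x) :
    ∃ G : ℂ → ℂ, HolomorphicNear G (X.proj x) ∧ G ∘ X.proj =ᶠ[𝓝 x] F := by
  have hp := X.isLocalDiffeomorph_proj x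
  refine ⟨F ∘ hp.localInverse, ?_, ?_⟩
  · have htend : Tendsto hp.localInverse (𝓝 (X.proj x)) (𝓝 x) := by
      have := hp.localInverse_contMDiffAt.continuousAt.tendsto
      rwa [hp.localInverse_left_inv hp.localInverse_mem_target] at this
    filter_upwards [htend.eventually hF,
      hp.localInverse_open_source.mem_nhds hp.localInverse_mem_source] with w h1 h2
    exact h1.comp w (hp.localInverse.mdifferentiableAt one_ne_zero h2)
  · filter_upwards [hp.localInverse_eventuallyEq_left] with y hy
    exact congrArg F hy

/-- Two holomorphic functions on `X` with the same germ at the base point are equal. -/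
theorem eq_of_eventuallyEq_base {f g : X.carrier → ℂ} (hf : MDifferentiable 𝓘(ℂ) 𝓘(ℂ) f)
    (hg : MDifferentiable 𝓘(ℂ) 𝓘(ℂ) g) (h : f =ᶠ[𝓝 X.base] g) : f = g := by
  have hopen : IsOpen {x | f =ᶠ[𝓝 x] g} := isOpen_setOfPred_eventually_nhds
  have hclosed : IsClosed {x | f =ᶠ[𝓝 x] g} := by
    refine isClosed_of_closure_subset fun x hx ↦ ?_
    obtain ⟨F, hF, hFf⟩ := X.exists_descend (x := x) (Eventually.of_forall hf)
    obtain ⟨G, hG, hGg⟩ := X.exists_descend (x := x) (Eventually.of_forall hg)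
    have hfreq : ∃ᶠ w in 𝓝 (X.proj x), F =ᶠ[𝓝 w] G := by
      rw [← X.isLocalHomeomorph_proj.map_nhds_eq x, frequently_map]
      refine ((mem_closure_iff_frequently.1 hx).and_eventually
        ((eventually_eventually_nhds.2 hFf).and (eventually_eventually_nhds.2 hGg))).mono ?_
      rintro y ⟨h1, h2, h3⟩
      exact X.eventuallyEq_comp_proj.1
        (EventuallyEq.trans h2 (EventuallyEq.trans h1 (EventuallyEq.symm h3)))
    exact hFf.symm.trans
      ((X.eventuallyEq_comp_proj.2 (hF.eventuallyEq_of_frequently hG hfreq)).trans hGg)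
  have huniv := IsClopen.eq_univ ⟨hclosed, hopen⟩ ⟨X.base, h⟩
  funext x
  exact (huniv ▸ mem_univ x : x ∈ {x | f =ᶠ[𝓝 x] g}).self_of_nhds

/-- A germ at the origin continues along a path that lifts to `X`, once its pullback continues
along the lift. -/
theorem continuesAlong_of_pullbackGerm {φ : HolomorphicGerm ℂ 0} {T : ℝ} {γ : ℝ → ℂ}
    {γ' : ℝ → X.carrier} (hT : 0 ≤ T) (hc : ContinuousOn γ' (Icc 0 T)) (h0 : γ' 0 = X.base)
    (hp : ∀ t ∈ Icc 0 T, X.proj (γ' t) = γ t) (h : (X.pullbackGerm φ).ContinuesAlong T γ') :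
    φ.ContinuesAlong T γ := by
  obtain ⟨F, hF0, hF⟩ := h
  have hdesc : ∀ t, ∃ G : ℂ → ℂ, t ∈ Icc 0 T →
      HolomorphicNear G (γ t) ∧ G ∘ X.proj =ᶠ[𝓝 (γ' t)] F t := by
    intro t
    by_cases ht : t ∈ Icc 0 T
    · obtain ⟨G, hG⟩ := X.exists_descend (hF t ht).1
      exact ⟨G, fun _ ↦ hp t ht ▸ hG⟩
    · exact ⟨0, fun h ↦ absurd h ht⟩
  choose G hG using hdesc
  refine ⟨G, ?_, fun t ht ↦ ⟨(hG t ht).1, ?_⟩⟩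
  · obtain ⟨f, -, hf⟩ := φ.2
    have h1 := (X.pullbackGerm_isRepresentedBy (φ := φ) hf).1 hF0
    have h2 := (hG 0 ⟨le_rfl, hT⟩).2
    rw [h0] at h2
    have h3 : G 0 =ᶠ[𝓝 (X.proj X.base)] f := X.eventuallyEq_comp_proj.1 (h2.trans h1)
    rw [X.proj_base] at h3
    exact (Germ.coe_eq.2 h3).trans hf
  · filter_upwards [(hF t ht).2, self_mem_nhdsWithin,
      (hc t ht).eventually (eventually_eventually_nhds.2 (hG t ht).2)] with s h1 hs h2
    have h3 : G s =ᶠ[𝓝 (X.proj (γ' s))] G t :=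
      X.eventuallyEq_comp_proj.1 ((hG s hs).2.trans (h1.trans (EventuallyEq.symm h2)))
    rwa [hp s hs] at h3

variable {X}

/-- A germ is continuable as soon as its pullback to `X` continues along all paths, because
allowed paths lift to `X`. -/
theorem isContinuable_of_forall_continuesAlong {φ : HolomorphicGerm ℂ 0}
    (h : ∀ γ : ℝ → X.carrier, ContinuousOn γ (Icc 0 1) → γ 0 = X.base →
      (X.pullbackGerm φ).ContinuesAlong 1 γ) : Ω.IsContinuable φ := by
  intro T γ hγ
  obtain ⟨γ', hc, h0, hp⟩ := X.exists_lift _ hγ.rescale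
  obtain ⟨F, hF0, hF⟩ := X.continuesAlong_of_pullbackGerm zero_le_one hc h0 hp (h γ' hc h0)
  have hmem : ∀ t ∈ Icc 0 T, t / T ∈ Icc (0 : ℝ) 1 := fun t ht ↦
    ⟨div_nonneg ht.1 hγ.nonneg, div_le_one_of_le₀ ht.2 hγ.nonneg⟩
  have hdiv : ∀ t ∈ Icc 0 T, T * (t / T) = t := fun t ht ↦
    mul_div_cancel_of_imp' fun hT ↦ le_antisymm (hT ▸ ht.2) ht.1
  refine ⟨fun t ↦ F (t / T), by simpa using hF0, fun t ht ↦ ?_⟩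
  obtain ⟨h1, h2⟩ := hF _ (hmem t ht)
  beta_reduce at h1 h2 ⊢
  rw [hdiv t ht] at h1
  refine ⟨h1, ?_⟩
  have htend : Tendsto (fun s ↦ s / T) (𝓝[Icc 0 T] t) (𝓝[Icc 0 1] (t / T)) :=
    (continuous_id.div_const T).continuousWithinAt.tendsto_nhdsWithin hmem
  filter_upwards [htend.eventually h2, self_mem_nhdsWithin] with s h3 hs
  rwa [hdiv s hs] at h3

/-- The germ of a global function continues along every path. -/
theorem continuesAlong_of_isRepresentedBy {x : X.carrier} {φ : HolomorphicGerm X.carrier x}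
    (f : GlobalHolomorphic X.carrier) (hf : φ.IsRepresentedBy f.1) (T : ℝ) (γ : ℝ → X.carrier) :
    φ.ContinuesAlong T γ :=
  ⟨fun _ ↦ f.1, hf, fun _ _ ↦ ⟨Eventually.of_forall f.2, Eventually.of_forall fun _ ↦
    EventuallyEq.rfl⟩⟩

/-- The pullback of a continuable germ to an initial surface is the germ of a global function:
the composition of the morphism to the surface of the germ with the evaluation of germs. -/
theorem IsInitial.exists_isRepresentedBy (hX : X.IsInitial) {φ : HolomorphicGerm ℂ 0}
    (hφ : Ω.IsContinuable φ) :
    ∃ f : GlobalHolomorphic X.carrier, (X.pullbackGerm φ).IsRepresentedBy f.1 := by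
  obtain ⟨q, hq, -⟩ := hX hφ.surface
  let r : X.carrier → GermSpace := fun x ↦ Subtype.val (q x)
  have hr : Continuous r := continuous_subtype_val.comp hq.continuous
  have hpoint : ∀ x, (r x).point = X.proj x := hq.proj_comp
  have hloc : ∀ x, (fun y ↦ (r y).value) =ᶠ[𝓝 x] (r x).rep ∘ X.proj := fun x ↦ by
    filter_upwards [hr.continuousAt.eventually (r x).value_eventuallyEq] with y hy
    rw [hy, hpoint]
    rfl
  refine ⟨⟨fun x ↦ (r x).value, fun x ↦ ?_⟩, ?_⟩
  · refine MDifferentiableAt.congr_of_eventuallyEq ?_ (hloc x)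
    have h := (r x).holomorphicNear_rep.self_of_nhds
    rw [hpoint] at h
    exact h.comp x (X.mdifferentiable_proj x)
  · have hb : r X.base = ⟨0, φ⟩ := congrArg Subtype.val hq.map_base
    have h := hloc X.base
    rw [hb] at h
    exact (X.pullbackGerm_isRepresentedBy (GermSpace.coe_rep ⟨0, φ⟩)).2 h

theorem pullbackGerm_injective : Function.Injective X.pullbackGerm := by
  rintro ⟨_, f, hf, rfl⟩ ⟨_, g, hg, rfl⟩ h
  have h1 : f ∘ X.proj =ᶠ[𝓝 X.base] g ∘ X.proj := Germ.coe_eq.1 (congrArg Subtype.val h)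
  have h2 : f =ᶠ[𝓝 (X.proj X.base)] g := X.eventuallyEq_comp_proj.1 h1
  rw [X.proj_base] at h2
  exact Subtype.ext (Germ.coe_eq.2 h2)

/-- Every global function has the pullback of a germ at the origin as its germ at the base
point. -/
theorem exists_pullbackGerm_isRepresentedBy (f : GlobalHolomorphic X.carrier) :
    ∃ φ : HolomorphicGerm ℂ 0, (X.pullbackGerm φ).IsRepresentedBy f.1 := by
  obtain ⟨G, hG, hGf⟩ := X.exists_descend (x := X.base) (Eventually.of_forall f.2)
  rw [X.proj_base] at hG
  let φ : HolomorphicGerm ℂ 0 := ⟨G, G, hG, rfl⟩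
  have hφ : φ.IsRepresentedBy G := rfl
  exact ⟨φ, (X.pullbackGerm_isRepresentedBy hφ).2 hGf.symm⟩

theorem IsInitial.tfae (hX : X.IsInitial) (φ : HolomorphicGerm ℂ 0) : List.TFAE [
    Ω.IsContinuable φ,
    ∀ γ : ℝ → X.carrier, ContinuousOn γ (Icc 0 1) → γ 0 = X.base →
      (X.pullbackGerm φ).ContinuesAlong 1 γ,
    ∃ f : GlobalHolomorphic X.carrier, (X.pullbackGerm φ).IsRepresentedBy f.1] := by
  tfae_have 1 → 3 := hX.exists_isRepresentedBy
  tfae_have 3 → 2 := fun ⟨f, hf⟩ γ _ _ ↦ continuesAlong_of_isRepresentedBy f hf 1 γ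
  tfae_have 2 → 1 := isContinuable_of_forall_continuesAlong
  tfae_finish

theorem IsInitial.existsUnique_equiv (hX : X.IsInitial) :
    ∃! Φ : Ω.ContinuableGerm ≃ GlobalHolomorphic X.carrier,
      ∀ φ : Ω.ContinuableGerm, (X.pullbackGerm φ.1).IsRepresentedBy (Φ φ).1 := by
  have huniq : ∀ (φ : HolomorphicGerm X.carrier X.base) (f g : GlobalHolomorphic X.carrier),
      φ.IsRepresentedBy f.1 → φ.IsRepresentedBy g.1 → f = g := fun φ f g hf hg ↦
    Subtype.ext (X.eq_of_eventuallyEq_base f.2 g.2 (Germ.coe_eq.1 (hf.trans hg.symm)))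
  choose Ψ hΨ using fun φ : Ω.ContinuableGerm ↦ hX.exists_isRepresentedBy φ.2
  have hbij : Function.Bijective Ψ := by
    constructor
    · intro φ ψ h
      refine Subtype.ext (pullbackGerm_injective (X := X) (Subtype.ext ?_))
      have h1 := hΨ φ
      rw [h] at h1
      exact h1.symm.trans (hΨ ψ)
    · intro f
      obtain ⟨φ, hφ⟩ := exists_pullbackGerm_isRepresentedBy f
      have hcont : Ω.IsContinuable φ :=
        isContinuable_of_forall_continuesAlong fun γ _ _ ↦
          continuesAlong_of_isRepresentedBy f hφ 1 γ
      let ψ : Ω.ContinuableGerm := ⟨φ, hcont⟩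
      exact ⟨ψ, huniq _ _ _ (hΨ ψ) hφ⟩
  refine ⟨Equiv.ofBijective Ψ hbij, hΨ, fun Φ hΦ ↦ Equiv.ext fun φ ↦ ?_⟩
  exact huniq _ _ _ (hΦ φ) (hΨ φ)

end EndlessRiemannSurface

theorem mainTheorem10 (Ω : DiscreteFilteredSet) :
    (∃ X : EndlessRiemannSurface Ω, X.IsInitial) ∧
    ∀ X : EndlessRiemannSurface Ω, X.IsInitial →
      (∀ φ : HolomorphicGerm ℂ 0, List.TFAE [
        Ω.IsContinuable φ,
        ∀ γ : ℝ → X.carrier, ContinuousOn γ (Icc 0 1) → γ 0 = X.base →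
          (X.pullbackGerm φ).ContinuesAlong 1 γ,
        ∃ f : GlobalHolomorphic X.carrier, (X.pullbackGerm φ).IsRepresentedBy f.1]) ∧
      ∃! Φ : Ω.ContinuableGerm ≃ GlobalHolomorphic X.carrier,
        ∀ φ : Ω.ContinuableGerm, (X.pullbackGerm φ.1).IsRepresentedBy (Φ φ).1 := by
  exact ⟨⟨_, DiscreteFilteredSet.UniversalSpace.isInitial_surface⟩,
    fun X hX ↦ ⟨hX.tfae, hX.existsUnique_equiv⟩⟩
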